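/- Let $\mathbf x=(x_i)_{i\in I}$ and $\mathbf y=(y_j)_{j\in J}$ be two disjoint families of indeterminates, and let $t\in\mathbb N=\{0,1,2,\dots\}$. Let $a^{(i)}_n\in\mathbb R[\mathbf x]$ $(0\le i\le 2,\ n\ge 0)$ and $b_n\in\mathbb R[\mathbf y]$ $(n\ge0)$ be polynomials with nonnegative coefficients. For $n,k\ge 0$ consider the lattice paths in $\mathbb N^2$ from $(0,0)$ to $(k,n)$ with steps $(0,1)$ and $(1,t+i)$ for $0\le i\le 2$, where each step $(0,1)$ from height $n'-1$ to height $n'$ has weight $b_{n'}$ and each step $(1,t+i)$ from height $n'-t-i$ to height $n'$ has weight $a^{(i)}_{n'}$. The weight of a path is the product of the weights of its steps, and $M=[M_{n,k}]_{n,k\ge0}$ is the infinite matrix in which $M_{n,k}$ is the sum of the weights of all lattice paths from $(0,0)$ to $(k,n)$. An infinite matrix with entries in $\mathbb R[\mathbf x,\mathbf y]$ is called $(\mathbf x,\mathbf y)$-totally positive if all its minors are polynomials with nonnegative coefficients. The Toeplitz matrix of a sequence $(s_k)_{k\ge0}$ is $[s_{i-j}]_{i,j\ge0}$, where $s_k=0$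 for $k<0$. **Theorem 1.5.** Suppose that there exist sequences $(\alpha_n)_{n\ge0}$, $(\beta_n)_{n\ge0}$, $(\lambda_n)_{n\ge0}$, $(\mu_n)_{n\ge0}$ of polynomials in $\mathbb R[\mathbf x]$ with nonnegative coefficients such that - $a^{(0)}_n=\alpha_n\lambda_n$ for $n\ge0$; - $a^{(1)}_n=\alpha_n\mu_n+\beta_n\lambda_{n-1}$ for $n\ge1$; - $a^{(2)}_n=\beta_n\mu_{n-1}$ for $n\ge2$. Then 1. the matrix $M$ is $(\mathbf x,\mathbf y)$-totally positive; 2. if $t\ge1$, then for every $n\ge0$ the Toeplitz matrix $[M_{n,i-j}]_{i,j\ge0}$ of the $n$-th row sequence $(M_{n,k})_{k\ge0}$ of $M$ is $(\mathbf x,\mathbf y)$-totally positive. -/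

import Mathlib

/-- The steps of a generalized lattice path: `up` is the step `(0, 1)` and, for a fixed `t`,
`diag i` is the step `(1, t + i)` with `0 ≤ i ≤ ℓ`. -/
inductive LatticeStep (ℓ : ℕ) : Type
  | up : LatticeStep ℓ
  | diag (i : Fin (ℓ + 1)) : LatticeStep ℓ

namespace LatticeStep

/-- The endpoint, as a pair (abscissa, height), of the lattice path that starts at the given point
of `ℕ × ℕ` and takes the listed steps in order. -/
def pathEnd {ℓ : ℕ} (t : ℕ) : ℕ × ℕ → List (LatticeStep ℓ) → ℕ × ℕ
  | q, [] => q
  | q, up :: p => pathEnd t (q.1, q.2 + 1) p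
  | q, diag i :: p => pathEnd t (q.1 + 1, q.2 + t + i) p

/-- The weight of a lattice path starting at height `h`, i.e. the product of the weights of its
steps: a step `up` arriving at height `n` has weight `b n`, and a step `diag i`
arriving at height `n` has weight `a i n`. -/
def pathWeight {ℓ : ℕ} {R : Type*} [CommSemiring R] (t : ℕ)
    (a : Fin (ℓ + 1) → ℕ → R) (b : ℕ → R) : ℕ → List (LatticeStep ℓ) → R
  | _, [] => 1
  | h, up :: p => b (h + 1) * pathWeight t a b (h + 1) p
  | h, diag i :: p => a i (h + t + i) * pathWeight t a b (h + t + i) p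

/-- The lattice paths from `(0, 0)` to `(k, n)`, a path being given by its list of steps. -/
def paths (t ℓ n k : ℕ) : Set (List (LatticeStep ℓ)) :=
  {p | pathEnd t (0, 0) p = (k, n)}

theorem length_add_le_pathEnd {ℓ : ℕ} (t : ℕ) (p : List (LatticeStep ℓ)) :
    ∀ q : ℕ × ℕ, p.length + (q.1 + q.2) ≤ (pathEnd t q p).1 + (pathEnd t q p).2 := by
  induction p with
  | nil => intro q; simp [pathEnd]
  | cons s p ih =>
    intro q
    cases s with
    | up =>
      have h := ih (q.1, q.2 + 1)
      simp only [pathEnd, List.length_cons] at h ⊢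
      omega
    | diag i =>
      have h := ih (q.1 + 1, q.2 + t + i)
      simp only [pathEnd, List.length_cons] at h ⊢
      omega

theorem finite_type (ℓ : ℕ) : Finite (LatticeStep ℓ) := by
  refine Finite.of_surjective
    (fun o : Option (Fin (ℓ + 1)) => (o.elim up diag : LatticeStep ℓ)) ?_
  intro s
  cases s with
  | up => exact ⟨none, rfl⟩
  | diag i => exact ⟨some i, rfl⟩

theorem paths_finite (t ℓ n k : ℕ) : (paths t ℓ n k).Finite := by
  have := finite_type ℓ
  refine (List.finite_length_le (LatticeStep ℓ) (k + n)).subset ?_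
  intro p hp
  have h := length_add_le_pathEnd t p (0, 0)
  change pathEnd t (0, 0) p = (k, n) at hp
  rw [hp] at h
  simpa using h

end LatticeStep

/-- The infinite matrix `M`, over the polynomials in the disjoint union of the two families of
indeterminates `𝐱` (indexed by `I`) and `𝐲` (indexed by `J`): the entry `M n k` is the sum of the
weights of all lattice paths from `(0, 0)` to `(k, n)`. -/
noncomputable def latticePathMatrix {I J : Type*} (t ℓ : ℕ)
    (a : Fin (ℓ + 1) → ℕ → MvPolynomial I ℝ) (b : ℕ → MvPolynomial J ℝ) :
    Matrix ℕ ℕ (MvPolynomial (I ⊕ J) ℝ) :=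
  Matrix.of fun n k =>
    ∑ p ∈ (LatticeStep.paths_finite t ℓ n k).toFinset,
      LatticeStep.pathWeight t
        (fun i m => MvPolynomial.rename Sum.inl (a i m))
        (fun m => MvPolynomial.rename Sum.inr (b m)) 0 p

/-- A real polynomial has nonnegative coefficients. -/
def HasNonnegCoeffs {σ : Type*} (p : MvPolynomial σ ℝ) : Prop :=
  ∀ d : σ →₀ ℕ, 0 ≤ MvPolynomial.coeff d p

/-- An infinite matrix of real polynomials is totally positive (with respect to the set `σ` of
all its indeterminates) if all its minors have nonnegative coefficients. -/
def IsPolyTotallyPositive {σ : Type*} (A : Matrix ℕ ℕ (MvPolynomial σ ℝ)) : Prop :=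
  ∀ (m : ℕ) (r c : Fin m ↪o ℕ), HasNonnegCoeffs (A.submatrix r c).det

/-- The Toeplitz matrix `[s (i - j)]` of a sequence, with `s` zero at negative indices. -/
def toeplitzMatrix {R : Type*} [Zero R] (s : ℕ → R) : Matrix ℕ ℕ R :=
  Matrix.of fun i j => if j ≤ i then s (i - j) else 0

/-! Splitting paths by their last step shows that column `k + 1` of the path matrix is `V D` applied
to column `k`, and column `0` is `V` applied to the first unit vector. Here `V` sums over vertical
runs, and the factorization hypotheses say exactly that `D` is a product of two nonnegative lower
bidiagonal matrices and a shift by `t`. Up to any given height `V` is also a product of such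
bidiagonals. The engine is `combine`: if each new row is a nonnegative combination of two old rows,
taken in weakly increasing order, multilinearity writes a new minor as a nonnegative combination of
old minors. Hence `V`, `D` and prepending a unit column preserve total positivity, and induction on
the number of columns gives the first claim. For the second, fix `n` and stack the first `x`
Toeplitz rows above the reversed block of rows at heights `n, …, 0`, with columns reversed as well.
The top row of that block is the next Toeplitz row. Copying it into the frozen part, evolving the
block by `V D` and adding one corner entry (the start of a new path) passes from `x` to `x + 1`.
Each minor of the Toeplitz matrix lies in the frozen part for large `x`. -/

/-- A matrix is totally positive with respect to a subsemiring `S` if all its minors lie in `S`. -/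
def IsTotallyPositiveIn {R : Type*} [CommRing R] (S : Subsemiring R) (A : Matrix ℕ ℕ R) : Prop :=
  ∀ (m : ℕ) (r c : Fin m → ℕ), StrictMono r → StrictMono c → (A.submatrix r c).det ∈ S

/-- Moving a sequence up by `t` places, padding with zeros. -/
def shiftUp {R : Type*} [Zero R] (t : ℕ) (u : ℕ → R) (n : ℕ) : R :=
  if t ≤ n then u (n - t) else 0

/-- The action on a sequence of the lower bidiagonal matrix with diagonal `c` and
subdiagonal `d`. -/
def lowerBidiag {R : Type*} [CommRing R] (c d u : ℕ → R) (n : ℕ) : R :=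
  c n * u n + (if n = 0 then 0 else d n) * u (n - 1)

/-- The action of the diagonal steps on a column of a lattice path matrix. -/
def diagStep {R : Type*} [CommRing R] (t : ℕ) (α β lam μ u : ℕ → R) : ℕ → R :=
  lowerBidiag α β (lowerBidiag lam μ (shiftUp t u))

/-- The sum over vertical paths with edge weights `b`, started with weights `u`. -/
def vertSum {R : Type*} [CommRing R] (b u : ℕ → R) : ℕ → R
  | 0 => u 0
  | n + 1 => u (n + 1) + b (n + 1) * vertSum b u n

/-- `vertSum` with only the edges arriving at heights at most `K` present. -/
def vertSumUpTo {R : Type*} [CommRing R] (b u : ℕ → R) (K n : ℕ) : R :=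
  if n ≤ K then vertSum b u n else u n

/-- The rows `s 0, …, s (x - 1), u n, …, u 0, 0, 0, …`. -/
def stackRows {R : Type*} [CommRing R] (n x : ℕ) (s u : ℕ → ℕ → R) : Matrix ℕ ℕ R :=
  Matrix.of fun p j => if p < x then s p j else if p - x ≤ n then u (n - (p - x)) j else 0

section TotalPositivity

variable {R : Type*} [CommRing R] {S : Subsemiring R} {A : Matrix ℕ ℕ R}

theorem vertSumUpTo_zero (b u : ℕ → R) : vertSumUpTo b u 0 = u := by
  funext n
  cases n <;> simp [vertSumUpTo, vertSum]

/-- Admitting the single edge arriving at height `K + 1` is an elementary bidiagonal factor. -/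
theorem vertSumUpTo_succ (b u : ℕ → R) (K : ℕ) :
    vertSumUpTo b u (K + 1) =
      lowerBidiag 1 (fun h => if h = K + 1 then b h else 0) (vertSumUpTo b u K) := by
  funext n
  rcases n with _ | n
  · simp [vertSumUpTo, lowerBidiag]
  · rcases lt_trichotomy n K with h | rfl | h
    · simp [vertSumUpTo, lowerBidiag, h.ne, h.le, Nat.succ_le_of_lt h]
    · simp [vertSumUpTo, lowerBidiag, vertSum]
    · have h1 : ¬ n + 1 ≤ K := by omega
      simp [vertSumUpTo, lowerBidiag, h.not_ge, h.ne', h1]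

theorem lowerBidiag_zero (c d : ℕ → R) : lowerBidiag c d 0 = 0 := by
  funext n
  simp [lowerBidiag]

theorem shiftUp_zero (t : ℕ) : shiftUp t (0 : ℕ → R) = 0 := by
  funext n
  simp [shiftUp]

theorem diagStep_zero (t : ℕ) (α β lam μ : ℕ → R) : diagStep t α β lam μ 0 = 0 := by
  simp only [diagStep, shiftUp_zero, lowerBidiag_zero]

theorem vertSum_zero (b : ℕ → R) : vertSum b 0 = 0 := by
  funext n
  induction n with
  | zero => rfl
  | succ n ih => simp [vertSum, ih]

/-! ### Operations preserving total positivity -/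

namespace IsTotallyPositiveIn

theorem zero : IsTotallyPositiveIn S (0 : Matrix ℕ ℕ R) := by
  intro m r c _ _
  rcases m with _ | m
  · simp
  · rw [Matrix.det_eq_zero_of_row_eq_zero 0 (by simp)]
    exact S.zero_mem

theorem det_mem_of_monotone (hA : IsTotallyPositiveIn S A) {m : ℕ} {r c : Fin m → ℕ}
    (hr : Monotone r) (hc : StrictMono c) : (A.submatrix r c).det ∈ S := by
  by_cases h : Function.Injective r
  · exact hA m r c (hr.strictMono_of_injective h) hc
  · simp only [Function.Injective, not_forall] at h
    obtain ⟨i, j, hij, hne⟩ := h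
    rw [Matrix.det_zero_of_row_eq hne (by ext k; simp [hij])]
    exact S.zero_mem

/-- Total positivity is preserved when each row is replaced with a combination of two rows, in such
a way that the rows used for different new rows are in weakly increasing order. -/
theorem combine (hA : IsTotallyPositiveIn S A) (f g : ℕ → ℕ) {c d : ℕ → R}
    (hc : ∀ n, c n ∈ S) (hd : ∀ n, d n ∈ S)
    (h : ∀ i j, i < j → max (f i) (g i) ≤ min (f j) (g j)) :
    IsTotallyPositiveIn S (Matrix.of fun i k => c i * A (f i) k + d i * A (g i) k) := by
  intro m r k hr hk
  have key : ((Matrix.of fun i k => c i * A (f i) k + d i * A (g i) k).submatrix r k).det =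
      ∑ s : Finset (Fin m), (∏ i, if i ∈ s then c (r i) else d (r i)) *
        (A.submatrix (fun i => if i ∈ s then f (r i) else g (r i)) k).det := by
    -- Expand in the rows: `s` records the rows where the `f` term is chosen. By `h` every choice is
    -- weakly increasing, and a repeated row gives determinant zero.
    have := (Matrix.detRowAlternating (R := R) (n := Fin m)).toMultilinearMap.map_add_univ
      (fun i j => c (r i) * A (f (r i)) (k j)) (fun i j => d (r i) * A (g (r i)) (k j))
    refine Eq.trans this (Finset.sum_congr rfl fun s _ => ?_)
    rw [← Matrix.det_mul_column]
    refine congrArg Matrix.det ?_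
    ext i j
    by_cases hi : i ∈ s <;> simp [hi]
  rw [key]
  refine S.sum_mem fun s _ => S.mul_mem (S.prod_mem fun i _ => ?_) (hA.det_mem_of_monotone ?_ hk)
  · split_ifs
    exacts [hc _, hd _]
  · intro i j hij
    rcases hij.eq_or_lt with rfl | hij
    · exact le_rfl
    · have := h _ _ (hr hij)
      dsimp only
      split_ifs <;> omega

theorem comp_monotone (hA : IsTotallyPositiveIn S A) {f : ℕ → ℕ} (hf : Monotone f) :
    IsTotallyPositiveIn S (Matrix.of fun i k => A (f i) k) := fun _ _ _ hr hc =>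
  hA.det_mem_of_monotone (hf.comp hr.monotone) hc

theorem of_forall_rows {B : ℕ → Matrix ℕ ℕ R} (hB : ∀ K, IsTotallyPositiveIn S (B K))
    (h : ∀ K i j, i < K → B K i j = A i j) : IsTotallyPositiveIn S A := by
  intro m r c hr hc
  -- The sum is a crude bound that puts all selected rows below `K`.
  convert hB (∑ i, r i + 1) m r c hr hc using 2
  ext i j
  exact (h _ _ _ (Nat.lt_succ_of_le (Finset.single_le_sum (f := r) (fun _ _ => Nat.zero_le _)
    (Finset.mem_univ i)))).symm

theorem of_forall_cols {B : ℕ → Matrix ℕ ℕ R} (hB : ∀ K, IsTotallyPositiveIn S (B K))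
    (h : ∀ K i j, j < K → B K i j = A i j) : IsTotallyPositiveIn S A := by
  intro m r c hr hc
  convert hB (∑ i, c i + 1) m r c hr hc using 2
  ext i j
  exact (h _ _ _ (Nat.lt_succ_of_le (Finset.single_le_sum (f := c) (fun _ _ => Nat.zero_le _)
    (Finset.mem_univ j)))).symm

/-- Prepending the first unit vector as a column preserves total positivity. -/
theorem cons_single (hA : IsTotallyPositiveIn S A) :
    IsTotallyPositiveIn S (Matrix.of fun i k =>
      if k = 0 then (if i = 0 then 1 else 0) else A i (k - 1)) := by
  intro m r c hr hc
  have hshift : ∀ {l : ℕ} (r' c' : Fin l → ℕ), StrictMono r' → StrictMono c' →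
      (∀ i, 0 < c' i) → ((Matrix.of fun i k => if k = 0 then (if i = 0 then 1 else 0)
        else A i (k - 1)).submatrix r' c').det ∈ S := by
    intro l r' c' hr' hc' hpos
    convert hA l r' (fun i => c' i - 1) hr' ?_ using 2
    · ext i j
      simp [(hpos j).ne']
    · intro i j hij
      have := hc' hij
      have := hpos i
      dsimp only
      omega
  rcases m with _ | m
  · simp
  · rcases Nat.eq_zero_or_pos (c 0) with h0 | h0
    -- Since `r` is strictly increasing, only its first value can be `0`, so the unit column has at
    -- most one nonzero entry.
    · rw [Matrix.det_succ_column_zero, Finset.sum_eq_single 0]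
      · rw [Matrix.submatrix_submatrix]
        refine S.mul_mem ?_ (hshift _ _ ?_ ?_ ?_)
        · simp only [Fin.val_zero, pow_zero, one_mul, Matrix.submatrix_apply, Matrix.of_apply, h0,
            if_true]
          split_ifs
          exacts [S.one_mem, S.zero_mem]
        · exact hr.comp (Fin.strictMono_succAbove 0)
        · exact hc.comp (Fin.strictMono_succ)
        · intro i
          exact (Nat.zero_le _).trans_lt (hc (Fin.succ_pos i))
      · intro i _ hi
        have : r i ≠ 0 := ((Nat.zero_le _).trans_lt (hr (Fin.pos_of_ne_zero hi))).ne'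
        simp [h0, this]
      · simp
    · exact hshift r c hr hc fun i => h0.trans_le (hc.monotone (Fin.zero_le i))

/-- Total positivity is preserved when an entry `1` is put at the lower right corner of the
support. -/
theorem add_corner (hA : IsTotallyPositiveIn S A) {q x : ℕ} (hcol : ∀ p j, x ≤ j → A p j = 0)
    (hrow : ∀ p j, q < p → A p j = 0) :
    IsTotallyPositiveIn S (Matrix.of fun p j => if p = q ∧ j = x then 1 else A p j) := by
  intro m r c hr hc
  rcases m with _ | m
  · simp
  by_cases hx : c (Fin.last m) = x
  · have hlt : ∀ j : Fin m, c j.castSucc ≠ x := fun j => by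
      have := hc (Fin.castSucc_lt_last j)
      omega
    by_cases hq : r (Fin.last m) ≤ q
    -- Column `x` is zero off row `q`, and only the last selected row can be `q`; the cofactor has
    -- sign `(-1) ^ (m + m)`.
    · rw [Matrix.det_succ_column _ (Fin.last m), Finset.sum_eq_single (Fin.last m)]
      · refine S.mul_mem (S.mul_mem ?_ ?_) ?_
        · rw [← two_mul, pow_mul]
          simp
        · simp only [Matrix.submatrix_apply, Matrix.of_apply, hx, and_true]
          split_ifs
          · exact S.one_mem
          · rw [hcol _ _ le_rfl]
            exact S.zero_mem
        · convert hA m (r ∘ Fin.castSucc) (c ∘ Fin.castSucc) (hr.comp Fin.strictMono_castSucc)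
            (hc.comp Fin.strictMono_castSucc) using 2
          ext i j
          simp [hlt]
      · intro i _ hi
        have : r i ≠ q := by
          have := hr (Fin.lt_last_iff_ne_last.2 hi)
          omega
        simp [hx, this, hcol]
      · simp
    · rw [Matrix.det_eq_zero_of_row_eq_zero (Fin.last m)]
      · exact S.zero_mem
      · intro j
        have : r (Fin.last m) ≠ q := by omega
        simp [this, hrow _ _ (not_le.1 hq)]
  · by_cases hlast : x < c (Fin.last m)
    · rw [Matrix.det_eq_zero_of_column_eq_zero (Fin.last m)]
      · exact S.zero_mem
      · intro i
        simp [hx, hcol _ _ hlast.le]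
    · convert hA (m + 1) r c hr hc using 2
      ext i j
      have : c j ≠ x := by
        have := hc.monotone (Fin.le_last j)
        omega
      simp [this]

theorem shiftUp_rows (hA : IsTotallyPositiveIn S A) (t : ℕ) :
    IsTotallyPositiveIn S (Matrix.of fun i k => shiftUp t (fun m => A m k) i) := by
  convert hA.combine (fun i => i - t) (fun i => i - t) (c := fun i => if t ≤ i then 1 else 0)
    (d := 0) ?_ (fun _ => S.zero_mem) ?_ using 1
  · ext i k
    simp [shiftUp]
  · intro n
    split_ifs
    exacts [S.one_mem, S.zero_mem]
  · intro i j hij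
    omega

theorem lowerBidiag_rows (hA : IsTotallyPositiveIn S A) {c d : ℕ → R}
    (hc : ∀ n, c n ∈ S) (hd : ∀ n, d n ∈ S) :
    IsTotallyPositiveIn S (Matrix.of fun i k => lowerBidiag c d (fun m => A m k) i) := by
  refine hA.combine (fun i => i) (fun i => i - 1) (d := fun n => if n = 0 then 0 else d n) hc ?_ ?_
  · intro n
    split_ifs
    exacts [S.zero_mem, hd n]
  · intro i j hij
    omega

theorem diagStep_rows (hA : IsTotallyPositiveIn S A) (t : ℕ) {α β lam μ : ℕ → R}
    (hα : ∀ n, α n ∈ S) (hβ : ∀ n, β n ∈ S) (hlam : ∀ n, lam n ∈ S) (hμ : ∀ n, μ n ∈ S) :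
    IsTotallyPositiveIn S (Matrix.of fun i k => diagStep t α β lam μ (fun m => A m k) i) :=
  ((hA.shiftUp_rows t).lowerBidiag_rows hlam hμ).lowerBidiag_rows hα hβ

/-- A minor sees finitely many rows, so finitely many one-edge factors suffice. -/
theorem vertSum_rows (hA : IsTotallyPositiveIn S A) {b : ℕ → R} (hb : ∀ n, b n ∈ S) :
    IsTotallyPositiveIn S (Matrix.of fun i k => vertSum b (fun m => A m k) i) := by
  refine of_forall_rows (B := fun K => Matrix.of fun i k => vertSumUpTo b (fun m => A m k) K i)
    (fun K => ?_) (fun K i j h => by simp [vertSumUpTo, h.le])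
  induction K with
  | zero =>
    simp only [vertSumUpTo_zero]
    exact hA
  | succ K ih =>
    simp only [vertSumUpTo_succ]
    refine ih.lowerBidiag_rows (fun _ => S.one_mem) fun n => ?_
    split_ifs
    exacts [hb n, S.zero_mem]

/-! ### Toeplitz rows stacked above a height-reversed block -/

section Stack

variable {n x : ℕ} {s u : ℕ → ℕ → R}

/-- One copy of the block's top row is frozen as a Toeplitz row; the other continues to evolve. -/
theorem stack_duplicate (h : IsTotallyPositiveIn S (stackRows n x s u)) (hs : s x = u n) :
    IsTotallyPositiveIn S (stackRows n (x + 1) s u) := by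
  convert h.comp_monotone (f := fun p => if p ≤ x then p else p - 1) ?_ using 1
  · ext p j
    rcases lt_trichotomy p x with hp | rfl | hp
    · simp [stackRows, hp, hp.le]
    · simp [stackRows, hs]
    · have h1 : ¬ p < x + 1 := by omega
      have h2 : ¬ p - 1 < x := by omega
      have h3 : p - 1 - x = p - (x + 1) := by omega
      simp only [stackRows, Matrix.of_apply, if_neg hp.not_ge, if_neg h1, if_neg h2, h3]
  · intro i j hij
    dsimp only
    split_ifs <;> omega

/-- Reversal turns going down `t` heights into going down `t` rows; heights below `t` land in the
zero padding. -/
theorem stack_shiftUp (h : IsTotallyPositiveIn S (stackRows n x s u)) (t : ℕ) :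
    IsTotallyPositiveIn S (stackRows n x s fun i k => shiftUp t (fun m => u m k) i) := by
  convert h.comp_monotone (f := fun p => if p < x then p else p + t) ?_ using 1
  · ext p j
    by_cases hp : p < x
    · simp [stackRows, hp]
    · have h1 : ¬ p + t < x := by omega
      by_cases h2 : p + t - x ≤ n
      · have h3 : p - x ≤ n := by omega
        have h4 : t ≤ n - (p - x) := by omega
        have h5 : n - (p - x) - t = n - (p + t - x) := by omega
        simp only [stackRows, shiftUp, Matrix.of_apply, if_neg hp, if_neg h1, if_pos h2, if_pos h3,
          if_pos h4, h5]
      · have h4 : p - x ≤ n → ¬ t ≤ n - (p - x) := by omega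
        simp only [stackRows, shiftUp, Matrix.of_apply, if_neg hp, if_neg h1, if_neg h2]
        split_ifs with h5 h6
        · exact absurd h6 (h4 h5)
        · rfl
        · rfl
  · intro i j hij
    dsimp only
    split_ifs <;> omega

theorem stack_lowerBidiag (h : IsTotallyPositiveIn S (stackRows n x s u)) {c d : ℕ → R}
    (hc : ∀ n, c n ∈ S) (hd : ∀ n, d n ∈ S) :
    IsTotallyPositiveIn S (stackRows n x s fun i k => lowerBidiag c d (fun m => u m k) i) := by
  convert h.combine (fun p => p) (fun p => p + 1)
    (c := fun p => if p < x then 1 else c (n - (p - x)))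
    (d := fun p => if p < x then 0 else d (n - (p - x))) ?_ ?_ ?_ using 1
  · ext p j
    by_cases hp : p < x
    · simp [stackRows, hp]
    · have h1 : ¬ p + 1 < x := by omega
      rcases lt_trichotomy (p - x) n with h2 | h2 | h2
      · have h3 : p + 1 - x ≤ n := by omega
        have h4 : n - (p - x) ≠ 0 := by omega
        have h5 : n - (p - x) - 1 = n - (p + 1 - x) := by omega
        simp only [stackRows, lowerBidiag, Matrix.of_apply, if_neg hp, if_neg h1, if_pos h2.le,
          if_pos h3, if_neg h4, h5]
      -- At height `0` the next row is zero padding, matching the missing subdiagonal term.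
      · have h3 : ¬ p + 1 - x ≤ n := by omega
        have h4 : n - (p - x) = 0 := by omega
        simp only [stackRows, lowerBidiag, Matrix.of_apply, if_neg hp, if_neg h1, if_pos h2.le,
          if_neg h3, h4, if_true, zero_mul, mul_zero]
      · have h3 : ¬ p + 1 - x ≤ n := by omega
        simp only [stackRows, Matrix.of_apply, if_neg hp, if_neg h1, if_neg h2.not_ge,
          if_neg h3, mul_zero, add_zero]
  · intro p
    split_ifs
    exacts [S.one_mem, hc _]
  · intro p
    split_ifs
    exacts [S.zero_mem, hd _]
  · intro i j hij
    omega

theorem stack_diagStep (h : IsTotallyPositiveIn S (stackRows n x s u)) (t : ℕ) {α β lam μ : ℕ → R}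
    (hα : ∀ n, α n ∈ S) (hβ : ∀ n, β n ∈ S) (hlam : ∀ n, lam n ∈ S) (hμ : ∀ n, μ n ∈ S) :
    IsTotallyPositiveIn S
      (stackRows n x s fun i k => diagStep t α β lam μ (fun m => u m k) i) :=
  ((h.stack_shiftUp t).stack_lowerBidiag hlam hμ).stack_lowerBidiag hα hβ

theorem stack_vertSum (h : IsTotallyPositiveIn S (stackRows n x s u)) {b : ℕ → R}
    (hb : ∀ n, b n ∈ S) :
    IsTotallyPositiveIn S (stackRows n x s fun i k => vertSum b (fun m => u m k) i) := by
  have key : ∀ K, IsTotallyPositiveIn S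
      (stackRows n x s fun i k => vertSumUpTo b (fun m => u m k) K i) := by
    intro K
    induction K with
    | zero => simpa only [vertSumUpTo_zero] using h
    | succ K ih =>
      simp only [vertSumUpTo_succ]
      refine ih.stack_lowerBidiag (fun _ => S.one_mem) fun n => ?_
      split_ifs
      exacts [hb n, S.zero_mem]
  convert key n using 1
  ext p j
  simp [stackRows, vertSumUpTo]

/-- Height `0` sits in row `x + n`, the last nonpadding row, so the source is a lower right corner.
-/
theorem stack_source (h : IsTotallyPositiveIn S (stackRows n x s u))
    (hs : ∀ p j, p < x → x ≤ j → s p j = 0) (hu : ∀ i j, x ≤ j → u i j = 0) :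
    IsTotallyPositiveIn S
      (stackRows n x s fun i j => if j = x then (if i = 0 then 1 else 0) else u i j) := by
  convert h.add_corner (q := x + n) (x := x) ?_ ?_ using 1
  · ext p j
    by_cases hp : p < x
    · have : p ≠ x + n := by omega
      simp [stackRows, hp, this]
    · by_cases hj : j = x
      · by_cases hq : p = x + n
        · simp [stackRows, hj, hq, add_comm n]
        · have : p - x ≤ n → ¬ n - (p - x) = 0 := by omega
          simp only [stackRows, Matrix.of_apply, hj, hq, if_neg hp, false_and, if_true, if_false,
            hu _ _ le_rfl]
          split_ifs with h1 h2
          · exact absurd h2 (this h1)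
          · rfl
          · rfl
      · simp [stackRows, hj]
  · intro p j hj
    simp only [stackRows, Matrix.of_apply]
    split_ifs with h1
    exacts [hs _ _ h1 hj, hu _ _ hj, rfl]
  · intro p j hp
    have h1 : ¬ p < x := by omega
    have h2 : ¬ p - x ≤ n := by omega
    simp only [stackRows, Matrix.of_apply, if_neg h1, if_neg h2]

end Stack

end IsTotallyPositiveIn

/-! ### Total positivity from the column recurrence -/

variable {t : ℕ} {α β lam μ b : ℕ → R} {M : Matrix ℕ ℕ R}

theorem isTotallyPositiveIn_of_columns (hα : ∀ n, α n ∈ S) (hβ : ∀ n, β n ∈ S)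
    (hlam : ∀ n, lam n ∈ S) (hμ : ∀ n, μ n ∈ S) (hb : ∀ n, b n ∈ S)
    (hM0 : (fun n => M n 0) = vertSum b fun n => if n = 0 then 1 else 0)
    (hM : ∀ k, (fun n => M n (k + 1)) = vertSum b (diagStep t α β lam μ fun n => M n k)) :
    IsTotallyPositiveIn S M := by
  refine IsTotallyPositiveIn.of_forall_cols
    (B := fun K => Matrix.of fun n k => if k < K then M n k else 0) (fun K => ?_)
    (fun K i j h => by simp [h])
  induction K with
  | zero => exact IsTotallyPositiveIn.zero
  | succ K ih =>
    convert ((ih.diagStep_rows t hα hβ hlam hμ).cons_single).vertSum_rows hb using 1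
    ext n k
    rcases k with _ | k
    · simpa using congrFun hM0 n
    · by_cases hk : k < K
      · simpa [hk] using congrFun (hM k) n
      · have h0 := diagStep_zero t α β lam μ
        have h1 := congrFun (vertSum_zero b) n
        rw [Pi.zero_def] at h0 h1
        simp [hk, h0, h1]

theorem isTotallyPositiveIn_toeplitz_of_columns (hα : ∀ n, α n ∈ S) (hβ : ∀ n, β n ∈ S)
    (hlam : ∀ n, lam n ∈ S) (hμ : ∀ n, μ n ∈ S) (hb : ∀ n, b n ∈ S)
    (hM0 : (fun n => M n 0) = vertSum b fun n => if n = 0 then 1 else 0)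
    (hM : ∀ k, (fun n => M n (k + 1)) = vertSum b (diagStep t α β lam μ fun n => M n k)) (n : ℕ) :
    IsTotallyPositiveIn S (toeplitzMatrix fun k => M n k) := by
  have hd := diagStep_zero t α β lam μ
  have hv := fun i => congrFun (vertSum_zero b) i
  simp only [Pi.zero_def] at hd hv
  have key : ∀ x, IsTotallyPositiveIn S (stackRows n x (toeplitzMatrix fun k => M n k)
      fun i j => if j ≤ x then M i (x - j) else 0) := by
    intro x
    induction x with
    | zero =>
      have h : IsTotallyPositiveIn S
          (stackRows n 0 (toeplitzMatrix fun k => M n k) fun _ _ => 0) := by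
        convert IsTotallyPositiveIn.zero (S := S) using 1
        ext p j
        simp [stackRows]
      convert (h.stack_source (by simp) (by simp)).stack_vertSum hb using 1
      congr 1
      funext i j
      rcases j with _ | j
      · simpa using congrFun hM0 i
      · simp [hv]
    | succ x ih =>
      -- The entry in column `j` of the block is `M i (x - j)`: evolving raises this index by one
      -- for `j ≤ x`, while the source starts column `x + 1`.
      convert (((ih.stack_duplicate ?_).stack_diagStep t hα hβ hlam hμ).stack_source
        ?_ ?_).stack_vertSum hb using 1
      · congr 1
        funext i j
        rcases lt_trichotomy j (x + 1) with hj | rfl | hj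
        · have h1 : x + 1 - j = x - j + 1 := by omega
          simpa [hj.ne, Nat.le_of_lt_succ hj, hj.le, h1] using congrFun (hM (x - j)) i
        · simpa using congrFun hM0 i
        · have h1 : ¬ j ≤ x := by omega
          simp [hj.not_ge, hj.ne', h1, hd, hv]
      · rfl
      · intro p j hp hj
        have h1 : ¬ j ≤ p := by omega
        simp [toeplitzMatrix, h1]
      · intro i j hj
        have h1 : ¬ j ≤ x := by omega
        simp [h1, hd]
  refine IsTotallyPositiveIn.of_forall_rows key fun K i j h => ?_
  simp [stackRows, h]

end TotalPositivity

/-! ### Last-step recurrence for path sums -/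

namespace LatticeStep

theorem pathEnd_append {ℓ : ℕ} (t : ℕ) (p p' : List (LatticeStep ℓ)) (q : ℕ × ℕ) :
    pathEnd t q (p ++ p') = pathEnd t (pathEnd t q p) p' := by
  induction p generalizing q with
  | nil => rfl
  | cons s p ih => cases s <;> exact ih _

theorem pathWeight_append {ℓ : ℕ} {R : Type*} [CommSemiring R] (t : ℕ)
    (a : Fin (ℓ + 1) → ℕ → R) (b : ℕ → R) (p p' : List (LatticeStep ℓ)) (q : ℕ × ℕ) :
    pathWeight t a b q.2 (p ++ p') =
      pathWeight t a b q.2 p * pathWeight t a b (pathEnd t q p).2 p' := by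
  induction p generalizing q with
  | nil => simp [pathWeight, pathEnd]
  | cons s p ih =>
    cases s with
    | up =>
      have := ih (q.1, q.2 + 1)
      simp only [List.cons_append, pathWeight, pathEnd] at this ⊢
      rw [this, mul_assoc]
    | diag i =>
      have := ih (q.1 + 1, q.2 + t + i)
      simp only [List.cons_append, pathWeight, pathEnd] at this ⊢
      rw [this, mul_assoc]

/-- The sum of the weights of all paths from `(0, 0)` to `(k, n)`. -/
noncomputable def pathSum {ℓ : ℕ} {R : Type*} [CommSemiring R] (t : ℕ)
    (a : Fin (ℓ + 1) → ℕ → R) (b : ℕ → R) (n k : ℕ) : R :=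
  ∑ p ∈ (paths_finite t ℓ n k).toFinset, pathWeight t a b 0 p

/-- The type of the last step of a path: `none` for the empty path, `some none` for `up`. -/
def lastKind {ℓ : ℕ} (p : List (LatticeStep ℓ)) : Option (Option (Fin (ℓ + 1))) :=
  p.getLast?.map fun s => match s with
    | up => none
    | diag i => some i

section Recurrence

variable {ℓ : ℕ} {R : Type*} [CommSemiring R] (t : ℕ) (a : Fin (ℓ + 1) → ℕ → R) (b : ℕ → R)

theorem mem_paths {n k : ℕ} {p : List (LatticeStep ℓ)} :
    p ∈ (paths_finite t ℓ n k).toFinset ↔ pathEnd t (0, 0) p = (k, n) := by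
  simp [paths]

theorem lastKind_eq_none {p : List (LatticeStep ℓ)} : lastKind p = none ↔ p = [] := by
  simp [lastKind]

theorem lastKind_eq_up {p : List (LatticeStep ℓ)} :
    lastKind p = some none ↔ ∃ p', p = p' ++ [up] := by
  rcases List.eq_nil_or_concat p with rfl | ⟨p', s, rfl⟩
  · simp [lastKind]
  · cases s <;> simp [lastKind]

theorem lastKind_eq_diag {p : List (LatticeStep ℓ)} {i : Fin (ℓ + 1)} :
    lastKind p = some (some i) ↔ ∃ p', p = p' ++ [diag i] := by
  rcases List.eq_nil_or_concat p with rfl | ⟨p', s, rfl⟩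
  · simp [lastKind]
  · cases s <;> simp [lastKind]

/-- Paths with a prescribed last step correspond to paths to its starting point. -/
theorem sum_filter_last (n k n' k' : ℕ) (s : LatticeStep ℓ) (w : R)
    (κ : Option (Option (Fin (ℓ + 1)))) (hP : ∀ p, lastKind p = κ ↔ ∃ p', p = p' ++ [s])
    (hend : ∀ q, pathEnd t q [s] = (k, n) ↔ q = (k', n'))
    (hw : pathWeight t a b n' [s] = w) :
    ∑ p ∈ (paths_finite t ℓ n k).toFinset with lastKind p = κ, pathWeight t a b 0 p =
      w * pathSum t a b n' k' := by
  rw [pathSum, Finset.mul_sum]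
  symm
  refine Finset.sum_bij (fun p _ => p ++ [s]) ?_ ?_ ?_ ?_
  · intro p hp
    rw [mem_paths] at hp
    rw [Finset.mem_filter, mem_paths, pathEnd_append, hend]
    exact ⟨hp, (hP _).2 ⟨p, rfl⟩⟩
  · intro p _ p' _ h
    simpa using h
  · intro p hp
    rw [Finset.mem_filter, mem_paths] at hp
    obtain ⟨p', rfl⟩ := (hP _).1 hp.2
    refine ⟨p', ?_, rfl⟩
    rw [mem_paths, ← hend, ← pathEnd_append]
    exact hp.1
  · intro p hp
    rw [mem_paths] at hp
    rw [pathWeight_append t a b p [s] (0, 0), hp, hw, mul_comm]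

theorem sum_filter_last_eq_zero (n k : ℕ) (s : LatticeStep ℓ)
    (κ : Option (Option (Fin (ℓ + 1)))) (hP : ∀ p, lastKind p = κ ↔ ∃ p', p = p' ++ [s])
    (hend : ∀ q, pathEnd t q [s] ≠ (k, n)) :
    ∑ p ∈ (paths_finite t ℓ n k).toFinset with lastKind p = κ, pathWeight t a b 0 p = 0 := by
  refine Finset.sum_eq_zero fun p hp => ?_
  rw [Finset.mem_filter, mem_paths] at hp
  obtain ⟨p', rfl⟩ := (hP _).1 hp.2
  rw [pathEnd_append] at hp
  exact absurd hp.1 (hend _)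

theorem pathSum_eq (n k : ℕ) :
    pathSum t a b n k = (if n = 0 ∧ k = 0 then 1 else 0) +
      ((if n = 0 then 0 else b n * pathSum t a b (n - 1) k) +
      ∑ i : Fin (ℓ + 1), if k = 0 then 0 else
        a i n * shiftUp (t + i) (fun m => pathSum t a b m (k - 1)) n) := by
  rw [pathSum, ← Finset.sum_fiberwise _ lastKind, Fintype.sum_option, Fintype.sum_option]
  congr 1
  · simp only [lastKind_eq_none]
    split_ifs with h
    · obtain ⟨rfl, rfl⟩ := h
      rw [Finset.sum_eq_single []]
      · rfl
      · intro p hp hne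
        rw [Finset.mem_filter] at hp
        exact absurd hp.2 hne
      · intro h
        refine absurd ?_ h
        rw [Finset.mem_filter, mem_paths]
        exact ⟨rfl, rfl⟩
    · refine Finset.sum_eq_zero fun p hp => ?_
      rw [Finset.mem_filter, mem_paths] at hp
      obtain ⟨hp, rfl⟩ := hp
      simp only [pathEnd, Prod.mk.injEq] at hp
      exact absurd ⟨hp.2.symm, hp.1.symm⟩ h
  congr 1
  · split_ifs with h
    · refine sum_filter_last_eq_zero t a b n k up _ (fun p => lastKind_eq_up) fun q => ?_
      simp [pathEnd, h]
    · refine sum_filter_last t a b n k (n - 1) k up _ _ (fun p => lastKind_eq_up) (fun q => ?_) ?_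
      · obtain ⟨q1, q2⟩ := q
        simp only [pathEnd, Prod.mk.injEq]
        omega
      · simp [pathWeight, Nat.sub_add_cancel (Nat.pos_of_ne_zero h)]
  · refine Finset.sum_congr rfl fun i _ => ?_
    by_cases h : k ≠ 0 ∧ t + i ≤ n
    · rw [if_neg h.1, shiftUp, if_pos h.2]
      refine sum_filter_last t a b n k _ _ (diag i) _ _ (fun p => lastKind_eq_diag)
        (fun q => ?_) ?_
      · obtain ⟨q1, q2⟩ := q
        simp only [pathEnd, Prod.mk.injEq]
        omega
      · simp [pathWeight, add_assoc, Nat.sub_add_cancel h.2]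
    · rw [sum_filter_last_eq_zero t a b n k (diag i) _ (fun p => lastKind_eq_diag)]
      · split_ifs with hk
        · rfl
        · rw [shiftUp, if_neg (fun h' => h ⟨hk, h'⟩), mul_zero]
      · rintro ⟨q1, q2⟩
        simp only [pathEnd, ne_eq, Prod.mk.injEq]
        omega

end Recurrence

section Columns

variable {R : Type*} [CommRing R]

theorem pathSum_zero_column {ℓ : ℕ} (t : ℕ) (a : Fin (ℓ + 1) → ℕ → R) (b : ℕ → R) :
    (fun n => pathSum t a b n 0) = vertSum b fun n => if n = 0 then 1 else 0 := by
  funext n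
  induction n with
  | zero => rw [pathSum_eq]; simp [vertSum]
  | succ n ih =>
    rw [pathSum_eq, vertSum, ← ih]
    simp

theorem pathSum_succ_column (t : ℕ) (a : Fin (2 + 1) → ℕ → R) (b α β lam μ : ℕ → R)
    (h0 : ∀ n, a 0 n = α n * lam n)
    (h1 : ∀ n, 1 ≤ n → a 1 n = α n * μ n + β n * lam (n - 1))
    (h2 : ∀ n, 2 ≤ n → a 2 n = β n * μ (n - 1)) (k : ℕ) :
    (fun n => pathSum t a b n (k + 1)) =
      vertSum b (diagStep t α β lam μ fun n => pathSum t a b n k) := by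
  have key : ∀ (u : ℕ → R) n,
      ∑ i : Fin (2 + 1), a i n * shiftUp (t + i) u n = diagStep t α β lam μ u n := by
    intro u n
    have hs : ∀ i m, shiftUp (t + i) u (m + i) = shiftUp t u m := by
      intro i m
      simp [shiftUp, Nat.add_sub_add_right]
    have hz : ∀ i m, m < i → shiftUp (t + i) u m = 0 := by
      intro i m h
      have : ¬ t + i ≤ m := by omega
      simp [shiftUp, this]
    rw [Fin.sum_univ_succ, Fin.sum_univ_two]
    simp only [Fin.succ_zero_eq_one, Fin.succ_one_eq_two, Fin.val_zero, Fin.val_one, Fin.val_two,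
      add_zero, diagStep, lowerBidiag]
    -- Heights `0` and `1` are separate: there the longer steps do not fit, and `h1`, `h2` say
    -- nothing about their weights.
    rcases n with _ | _ | n
    · simp [hz, h0, mul_assoc]
    · have := hs 1 0
      simp only [zero_add] at this
      simp [hz, h0, h1, this]
      ring
    · have e1 := hs 1 (n + 1)
      have e2 := hs 2 n
      simp [e1, e2, h0, h1, h2]
      ring
  funext n
  induction n with
  | zero =>
    rw [pathSum_eq]
    simpa [vertSum] using key _ 0
  | succ n ih =>
    rw [pathSum_eq, vertSum, ← ih, ← key]
    simp [add_comm]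

end Columns

end LatticeStep

/-! ### The semiring of polynomials with nonnegative coefficients -/

section NonnegCoeffs

/-- The polynomials with nonnegative coefficients. -/
def nonnegCoeffs (σ : Type*) : Subsemiring (MvPolynomial σ ℝ) where
  carrier := {p | HasNonnegCoeffs p}
  zero_mem' d := by simp
  one_mem' d := by
    classical
    rw [MvPolynomial.coeff_one]
    split_ifs <;> norm_num
  add_mem' hp hq d := by
    rw [MvPolynomial.coeff_add]
    exact add_nonneg (hp d) (hq d)
  mul_mem' hp hq d := by
    classical
    rw [MvPolynomial.coeff_mul]
    exact Finset.sum_nonneg fun x _ => mul_nonneg (hp _) (hq _)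

theorem HasNonnegCoeffs.rename {σ τ : Type*} {p : MvPolynomial σ ℝ} (hp : HasNonnegCoeffs p)
    {f : σ → τ} (hf : Function.Injective f) : MvPolynomial.rename f p ∈ nonnegCoeffs τ := by
  intro d
  by_cases h : ∃ u : σ →₀ ℕ, u.mapDomain f = d
  · obtain ⟨u, rfl⟩ := h
    rw [MvPolynomial.coeff_rename_mapDomain f hf]
    exact hp u
  · rw [MvPolynomial.coeff_rename_eq_zero f p d fun u hu => absurd ⟨u, hu⟩ h]

theorem IsTotallyPositiveIn.isPolyTotallyPositive {σ : Type*}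
    {A : Matrix ℕ ℕ (MvPolynomial σ ℝ)} (hA : IsTotallyPositiveIn (nonnegCoeffs σ) A) :
    IsPolyTotallyPositive A :=
  fun m r c => hA m r c r.strictMono c.strictMono

end NonnegCoeffs

theorem theorem1p5 {I J : Type*} (t : ℕ)
    (a : Fin (2 + 1) → ℕ → MvPolynomial I ℝ) (b : ℕ → MvPolynomial J ℝ)
    (ha : ∀ i n, HasNonnegCoeffs (a i n)) (hb : ∀ n, HasNonnegCoeffs (b n))
    (α β lam μ : ℕ → MvPolynomial I ℝ)
    (hα : ∀ n, HasNonnegCoeffs (α n)) (hβ : ∀ n, HasNonnegCoeffs (β n))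
    (hlam : ∀ n, HasNonnegCoeffs (lam n)) (hμ : ∀ n, HasNonnegCoeffs (μ n))
    (h0 : ∀ n, a 0 n = α n * lam n)
    (h1 : ∀ n, 1 ≤ n → a 1 n = α n * μ n + β n * lam (n - 1))
    (h2 : ∀ n, 2 ≤ n → a 2 n = β n * μ (n - 1)) :
    IsPolyTotallyPositive (latticePathMatrix t 2 a b) ∧
      (1 ≤ t → ∀ n : ℕ,
        IsPolyTotallyPositive (toeplitzMatrix fun k => latticePathMatrix t 2 a b n k)) := by

  have hα' n := (hα n).rename (Sum.inl_injective (β := J))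
  have hβ' n := (hβ n).rename (Sum.inl_injective (β := J))
  have hlam' n := (hlam n).rename (Sum.inl_injective (β := J))
  have hμ' n := (hμ n).rename (Sum.inl_injective (β := J))
  have hb' n := (hb n).rename (Sum.inr_injective (α := I))
  have hM0 := LatticeStep.pathSum_zero_column t
    (fun i m => MvPolynomial.rename (Sum.inl : I → I ⊕ J) (a i m))
    (fun m => MvPolynomial.rename Sum.inr (b m))
  have hM := LatticeStep.pathSum_succ_column t
    (fun i m => MvPolynomial.rename (Sum.inl : I → I ⊕ J) (a i m))
    (fun m => MvPolynomial.rename Sum.inr (b m)) (fun n => MvPolynomial.rename Sum.inl (α n))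
    (fun n => MvPolynomial.rename Sum.inl (β n)) (fun n => MvPolynomial.rename Sum.inl (lam n))
    (fun n => MvPolynomial.rename Sum.inl (μ n)) (fun n => by rw [h0, map_mul])
    (fun n hn => by rw [h1 n hn, map_add, map_mul, map_mul])
    (fun n hn => by rw [h2 n hn, map_mul])
  -- The entries of `latticePathMatrix` are `pathSum` by definition, so `hM0` and `hM` apply
  -- directly.
  exact ⟨(isTotallyPositiveIn_of_columns hα' hβ' hlam' hμ' hb' hM0 hM).isPolyTotallyPositive,
    fun _ n => (isTotallyPositiveIn_toeplitz_of_columns hα' hβ' hlam' hμ' hb' hM0 hM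
      n).isPolyTotallyPositive⟩
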